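/- Let $\vec e_1,\vec e_2,\vec e_3$ be vectors of the Euclidean plane with $|\vec e_i|=e>0$ and $\angle(\vec e_i,\vec e_{i+1})=2\pi/3$ (indices modulo $3$), so that $\vec e_1+\vec e_2+\vec e_3=\vec 0$. Put $\vec g_i=\vec e_{i+1}-\vec e_{i-1}$ and let $\Lambda^{\triangle}=\{\sum_{i=1}^3 n_i\vec g_i : n_i\in\mathbb Z\}$ be the triangular lattice. For constants $\Gamma_1,\Gamma_2,\Gamma_3\in\mathbb C$ consider the equation $$\sum_{i=1}^{3}\Gamma_i\left[\frac{1}{u(\vec n)-u(\vec n+\vec g_i)}+\frac{1}{u(\vec n)-u(\vec n-\vec g_i)}\right]=0,\qquad \vec n\in\Lambda^{\triangle}. \tag{1}$$ Let $\alpha_1,\alpha_2,\alpha_3\in\mathbb C$ be parameters with $\Gamma_i=\alpha_{i+1}-\alpha_{i-1}$ for $i=1,2,3$ (in particular $\Gamma_1+\Gamma_2+\Gamma_3=0$), let $\ell$ be a positive integer, $\gamma$ a contour in $\mathbb C$ (a union of $C^1$ arcs, finite or infinite) and $\hat\omega$ a complex function. Define $$\vec\varphi(h)=\frac{2}{3e^2}\sum_{i=1}^3\vec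 e_i\,\ln(h-\alpha_i),\qquad \omega_m(\vec n)=\int_\gamma dh\,\hat\omega(h)\,h^m\,e^{(\vec\varphi(h),\vec n)}\qquad(m\in\mathbb Z,\ \vec n\in\Lambda^{\triangle}),$$ where $(\cdot,\cdot)$ is the standard (bilinear) scalar product, and suppose that these integrals converge absolutely for all $\vec n\in\Lambda^{\triangle}$ and $|m|<\ell$. For $k=0,-1$ let $$D_k(\vec n)=\det\bigl(\omega_{k-a+b}(\vec n)\bigr)_{a,b=1,\dots,\ell+k}\quad(\ell+k\ge1),\qquad D_k(\vec n)=1\quad(\ell+k=0).$$ Then $$u(\vec n)=\frac{D_{-1}(\vec n)}{D_0(\vec n)}\qquad(\vec n\in\Lambda^{\triangle})$$ solves (1) wherever it is defined: equation (1) holds at every node $\vec n\in\Lambda^{\triangle}$ such that $D_0$ does not vanish at $\vec n$ and at the six nodes $\vec n\pm\vec g_i$, and $u(\vec n)\ne u(\vec n\pm\vec g_i)$ for $i=1,2,3$. -/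

import Mathlib

noncomputable section

/-- The Euclidean plane containing the lattice. -/
abbrev Plane : Type := EuclideanSpace ℝ (Fin 2)

/-- The base vectors of the equilateral lattice: all three have the same length `s > 0`, and any
two cyclically consecutive ones form the angle `2π/3`. The index set `Fin 3` stands for `{1, 2, 3}`
and its arithmetic is modulo `3`. -/
def IsEquilateralFrame (e : Fin 3 → Plane) (s : ℝ) : Prop :=
  0 < s ∧ (∀ i, ‖e i‖ = s) ∧
    ∀ i, InnerProductGeometry.angle (e i) (e (i + 1)) = 2 * Real.pi / 3

/-- The edge vectors `g_i = e_{i+1} - e_{i-1}` of the triangular lattice. -/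
def edgeVec (e : Fin 3 → Plane) (i : Fin 3) : Plane := e (i + 1) - e (i - 1)

/-- The triangular lattice `Λ^△ = { ∑ n_i g_i : n_i ∈ ℤ }`. -/
def triLattice (e : Fin 3 → Plane) : Set Plane :=
  {n | ∃ c : Fin 3 → ℤ, n = ∑ i, c i • edgeVec e i}

/-- The field equation of the triangular lattice at the node `n`. -/
def TLEquationAt (e : Fin 3 → Plane) (Γ : Fin 3 → ℂ) (u : Plane → ℂ) (n : Plane) : Prop :=
  ∑ i, Γ i * (1 / (u n - u (n + edgeVec e i)) + 1 / (u n - u (n - edgeVec e i))) = 0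

/-- A contour in the complex plane: a union of `C¹` arcs, parametrised by the components of an open
subset of the real line. Finite and infinite, open and closed contours and unions of several curves
are covered; a piecewise `C¹` contour is obtained by leaving out its finitely many corners, which
do not contribute to integrals. -/
structure Contour where
  /-- the set of parameters -/
  dom : Set ℝ
  /-- the parametrisation -/
  param : ℝ → ℂ
  isOpen_dom : IsOpen dom
  contDiffOn_param : ContDiffOn ℝ 1 param dom

/-- Absolute convergence of `∫_γ f(h) dh`. -/
def Contour.Integrable (γ : Contour) (f : ℂ → ℂ) : Prop :=
  MeasureTheory.IntegrableOn (fun t => f (γ.param t) * deriv γ.param t) γ.dom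

/-- The contour integral `∫_γ f(h) dh`. -/
def Contour.integral (γ : Contour) (f : ℂ → ℂ) : ℂ :=
  ∫ t in γ.dom, f (γ.param t) * deriv γ.param t

/-- The vector function `φ(h) = (2 / (3 s²)) ∑ e_i ln (h - α_i)`, a vector with complex coordinates.
The choice of the branch of the logarithm does not affect `exp (φ(h), n)` for lattice vectors
`n`. -/
def phi (e : Fin 3 → Plane) (s : ℝ) (α : Fin 3 → ℂ) (h : ℂ) : Fin 2 → ℂ :=
  fun j => 2 / (3 * (s : ℂ) ^ 2) * ∑ i, ((e i j : ℝ) : ℂ) * Complex.log (h - α i)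

/-- The (bilinear) standard scalar product of a vector with complex coordinates and a vector of the
plane. -/
def scalarProd (v : Fin 2 → ℂ) (n : Plane) : ℂ := ∑ j, v j * ((n j : ℝ) : ℂ)

/-- The integrand `ω̂(h) h^m exp (φ(h), n)` of the moment `ω_m(n)`. -/
def momentIntegrand (e : Fin 3 → Plane) (s : ℝ) (α : Fin 3 → ℂ) (ωhat : ℂ → ℂ)
    (m : ℤ) (n : Plane) (h : ℂ) : ℂ :=
  ωhat h * h ^ m * Complex.exp (scalarProd (phi e s α h) n)

/-- The moment `ω_m(n)`. -/
def moment (e : Fin 3 → Plane) (s : ℝ) (α : Fin 3 → ℂ) (γ : Contour) (ωhat : ℂ → ℂ)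
    (m : ℤ) (n : Plane) : ℂ :=
  γ.integral (momentIntegrand e s α ωhat m n)

/-- The Toeplitz determinant `det (ω_{k-a+b})`, `a, b = 1, …, ℓ + k`, of a sequence; it is `1` when
`ℓ + k = 0`. (The difference `b - a` is the same for indices starting from `0`.) -/
def toeplitzD (ω : ℤ → ℂ) (ℓ : ℕ) (k : ℤ) : ℂ :=
  Matrix.det (Matrix.of fun a b : Fin ((ℓ : ℤ) + k).toNat =>
    ω (k - ((a : ℕ) : ℤ) + ((b : ℕ) : ℤ)))

/-- The determinants `D_k(n)` built of the moments `ω_m(n)`. -/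
def latticeD (e : Fin 3 → Plane) (s : ℝ) (α : Fin 3 → ℂ) (γ : Contour) (ωhat : ℂ → ℂ)
    (ℓ : ℕ) (k : ℤ) (n : Plane) : ℂ :=
  toeplitzD (fun m => moment e s α γ ωhat m n) ℓ k

/-- The function `u(n) = D_{-1}(n) / D_0(n)`. -/
def toeplitzU (e : Fin 3 → Plane) (s : ℝ) (α : Fin 3 → ℂ) (γ : Contour) (ωhat : ℂ → ℂ)
    (ℓ : ℕ) (n : Plane) : ℂ :=
  latticeD e s α γ ωhat ℓ (-1) n / latticeD e s α γ ωhat ℓ 0 n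

end

/-!
Multiplying the exponential at a node `n` by `h - α_j` amounts to a step along `e_j`, up to a factor
that is the same for the three `j`. The functions `exp (φ, n)` of the triangular lattice therefore
extend to the other nodes of the rhombic tiling with edges `± e_j`: the nodes `n + e_j` carry the
measures `(h - α_j) dμ` and the nodes `n - e_j` the measures `dμ / (h - α_j)`, if `dμ` is the measure
at `n`. After a reversal of rows the Toeplitz determinants are Hankel determinants of the moments
`m_j = ω_{j - ℓ + 1}`, so that `u` is, up to a constant factor, the reciprocal of the squared norm of
the orthogonal polynomial of degree `ℓ - 1`.

Let `v` be the squared norm of degree `ℓ - 1` at the nodes `n + e_j` and of degree `ℓ` at the nodes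
`n - e_j`. With the constant factor of `u` dropped, on every rhombus `u` and `v` satisfy the lattice
potential KdV equation
`(u(n) - u(n + g_i)) (v(n - e_{i-1}) - v(n + e_{i+1})) = α_{i+1} - α_{i-1}`
(`sub_div_invOrthNorm_sub`). It combines the Christoffel–Darboux formula
(`hankelDet_christoffel_sub`) with the recurrence of the Christoffel–Darboux kernels
(`hankelDet_christoffel_mul`); both are instances of the Desnanot–Jacobi identity
(`Matrix.det_mul_det_interior`). Thus each term `Γ_i / (u(n) - u(n ± g_i))` is a difference of two
values of `v`, and the sum of these differences around a node vanishes (`sum_longLegs_eq_zero`). The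
nonvanishing of `u(n) - u(n ± g_i)` ensures that the denominators of `v` do not vanish.

The values of `v` involve moments whose integrals need not converge. Only linearity matters for the
identities, so the integral is replaced by a linear extension of it to all functions
(`exists_functional_eq_moment`). The points `h = 0` and `h = α_i`, where powers and logarithms take
junk values, are harmless because a `C¹` curve passes through them with nonzero velocity only
countably many times (`countable_setOf_eq_and_deriv_ne_zero`).
-/

/-! ### Determinantal identities for Hankel matrices -/

section Determinants

open Matrix

variable {R : Type*} [CommRing R]

/-- Jacobi's complementary minor identity for a `2 × 2` corner: the corresponding minor of the
adjugate is the determinant times the complementary minor. -/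
theorem Matrix.det_toBlocks₁₁_adjugate {n : Type*} [Fintype n] [DecidableEq n]
    (M : Matrix (Fin 2 ⊕ n) (Fin 2 ⊕ n) R) :
    M.adjugate.toBlocks₁₁.det = M.det * M.toBlocks₂₂.det := by
  -- The identity is polynomial in the entries, so it suffices to prove it for the generic matrix,
  -- whose determinant can be cancelled.
  let X := mvPolynomialX (Fin 2 ⊕ n) (Fin 2 ⊕ n) ℤ
  suffices hX : X.adjugate.toBlocks₁₁.det = X.det * X.toBlocks₂₂.det by
    let f : MvPolynomial ((Fin 2 ⊕ n) × (Fin 2 ⊕ n)) ℤ →+* R :=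
      MvPolynomial.eval₂Hom (Int.castRingHom R) fun p => M p.1 p.2
    have hf : f.mapMatrix X = M := by
      ext i j
      simp [f, X]
    have h := congrArg f hX
    rw [map_mul, RingHom.map_det, RingHom.map_det, RingHom.map_det, hf] at h
    have h₁ : f.mapMatrix X.adjugate.toBlocks₁₁ = M.adjugate.toBlocks₁₁ := by
      rw [← hf, ← RingHom.map_adjugate]
      rfl
    have h₂ : f.mapMatrix X.toBlocks₂₂ = M.toBlocks₂₂ := by
      rw [← hf]
      rfl
    rwa [h₁, h₂] at h
  have hdet : X.det ≠ 0 := det_mvPolynomialX_ne_zero _ ℤ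
  refine mul_left_cancel₀ hdet ?_
  have key : X * fromBlocks X.adjugate.toBlocks₁₁ 0 X.adjugate.toBlocks₂₁ 1 =
      fromBlocks (X.det • 1) X.toBlocks₁₂ 0 X.toBlocks₂₂ := by
    have h := mul_adjugate X
    conv_lhs at h => rw [← fromBlocks_toBlocks X]
    rw [← fromBlocks_toBlocks (adjugate _), fromBlocks_multiply, ← fromBlocks_one, fromBlocks_smul,
      fromBlocks_toBlocks X, fromBlocks_inj] at h
    conv_lhs => rw [← fromBlocks_toBlocks X]
    rw [fromBlocks_multiply, fromBlocks_toBlocks X, h.1, h.2.2.1]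
    simp
  have := congrArg det key
  rw [det_mul, det_fromBlocks_zero₁₂, det_fromBlocks_zero₂₁, det_one, mul_one, det_smul, det_one,
    Fintype.card_fin] at this
  rw [this]
  ring

/-- The **Desnanot–Jacobi identity** (Dodgson condensation). -/
theorem Matrix.det_mul_det_interior {n : ℕ} (M : Matrix (Fin (n + 2)) (Fin (n + 2)) R) :
    M.det * (M.submatrix (fun i : Fin n => i.castSucc.succ) fun i => i.castSucc.succ).det =
      (M.submatrix Fin.succ Fin.succ).det * (M.submatrix Fin.castSucc Fin.castSucc).det -
        (M.submatrix Fin.succ Fin.castSucc).det * (M.submatrix Fin.castSucc Fin.succ).det := by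
  let g : Fin 2 ⊕ Fin n → Fin (n + 2) :=
    Sum.elim ![0, Fin.last (n + 1)] fun i => i.castSucc.succ
  have hg : Function.Bijective g := by
    rw [Fintype.bijective_iff_injective_and_card]
    refine ⟨?_, by simp [add_comm]⟩
    rintro (i | i) (j | j) h
    · fin_cases i <;> fin_cases j <;> simp_all [g, Fin.ext_iff]
    · fin_cases i <;> simp [g, Fin.ext_iff] at h; omega
    · fin_cases j <;> simp [g, Fin.ext_iff] at h; omega
    · simpa [g, Fin.ext_iff] using h
  let E := Equiv.ofBijective g hg
  have h := det_toBlocks₁₁_adjugate (M.submatrix E E)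
  rw [det_submatrix_equiv_self, adjugate_submatrix_equiv_self] at h
  have h₂ : (M.submatrix E E).toBlocks₂₂ =
      M.submatrix (fun i : Fin n => i.castSucc.succ) fun i => i.castSucc.succ := rfl
  rw [h₂] at h
  have hE0 : E (Sum.inl 0) = 0 := rfl
  have hE1 : E (Sum.inl 1) = Fin.last (n + 1) := rfl
  rw [← h, det_fin_two]
  simp only [toBlocks₁₁, of_apply, submatrix_apply, hE0, hE1, adjugate_fin_succ_eq_det_submatrix]
  have e1 : (Fin.last (n + 1)).succAbove = Fin.castSucc := Fin.succAbove_last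
  have e0 : (0 : Fin (n + 2)).succAbove = Fin.succ := Fin.succAbove_zero
  rw [e1, e0]
  simp only [Fin.val_zero, Fin.val_last, add_zero, zero_add, pow_zero, one_mul]
  have hs : ((-1 : R) ^ (n + 1)) * (-1) ^ (n + 1) = 1 := by
    rw [← mul_pow]; simp
  have hs' : ((-1 : R) ^ (n + 1 + (n + 1))) = 1 := by rw [pow_add, hs]
  rw [hs']
  linear_combination -(M.submatrix Fin.succ Fin.castSucc).det *
    (M.submatrix Fin.castSucc Fin.succ).det * hs

/-- The leading principal minor of size `n` of an infinite matrix. -/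
def leadingMinor (F : ℕ → ℕ → R) (n : ℕ) : R :=
  det (of fun i j : Fin n => F i j)

/-- The Hankel determinant `det (m_{i+j})` of size `n` of a sequence of moments. -/
def hankelDet (m : ℕ → R) (n : ℕ) : R :=
  leadingMinor (fun i j => m (i + j)) n

/-- The moments of the measure `(h - a) dμ` in terms of the moments `m` of `dμ`. -/
def christoffel (a : R) (m : ℕ → R) : ℕ → R := fun j => m (j + 1) - a * m j

/-- Passage from the values of a linear functional on `1, h, h², …` to its values on
`1, h - a, (h - a) h, (h - a) h², …`. -/
def rebase (a : R) (f : ℕ → R) : ℕ → R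
  | 0 => f 0
  | j + 1 => f (j + 1) - a * f j

theorem leadingMinor_rebase_col (F : ℕ → ℕ → R) (b : R) (n : ℕ) :
    leadingMinor (fun i => rebase b (F i)) n = leadingMinor F n := by
  cases n with
  | zero => simp [leadingMinor]
  | succ n =>
    symm
    refine det_eq_of_forall_col_eq_smul_add_pred (fun _ => b) (fun i => ?_) fun i j => ?_
    · simp [rebase]
    · simp [rebase]

theorem leadingMinor_rebase_row (F : ℕ → ℕ → R) (a : R) (n : ℕ) :
    leadingMinor (fun i j => rebase a (fun i => F i j) i) n = leadingMinor F n := by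
  cases n with
  | zero => simp [leadingMinor]
  | succ n =>
    symm
    refine det_eq_of_forall_row_eq_smul_add_pred (fun _ => a) (fun i => ?_) fun i j => ?_
    · simp [rebase]
    · simp [rebase]

/-- The Desnanot–Jacobi identity for leading minors. -/
theorem leadingMinor_mul_interior (F : ℕ → ℕ → R) (n : ℕ) :
    leadingMinor F (n + 2) * leadingMinor (fun i j => F (i + 1) (j + 1)) n =
      leadingMinor (fun i j => F (i + 1) (j + 1)) (n + 1) * leadingMinor F (n + 1) -
        leadingMinor (fun i j => F (i + 1) j) (n + 1) *
          leadingMinor (fun i j => F i (j + 1)) (n + 1) :=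
  det_mul_det_interior (of fun i j : Fin (n + 2) => F i j)

theorem leadingMinor_succ_of_row_zero (F : ℕ → ℕ → R) (hF : ∀ j, F 0 (j + 1) = 0) (n : ℕ) :
    leadingMinor F (n + 1) = F 0 0 * leadingMinor (fun i j => F (i + 1) (j + 1)) n := by
  rw [leadingMinor, det_succ_row_zero, Fin.sum_univ_succ]
  simp only [of_apply, Fin.val_zero, Fin.val_succ, hF]
  simp [leadingMinor, submatrix]

/-- The recurrence `K_{n+1}(a, b) = K_n(a, b) + P_{n+1}(a) P_{n+1}(b) / h_{n+1}` of the
Christoffel–Darboux kernels of orthogonal polynomials, written in Hankel determinants. -/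
theorem hankelDet_christoffel_mul (m : ℕ → R) (a b : R) (n : ℕ) :
    hankelDet (christoffel a m) (n + 1) * hankelDet (christoffel b m) (n + 1) =
      hankelDet (christoffel a (christoffel b m)) (n + 1) * hankelDet m (n + 1) -
        hankelDet m (n + 2) * hankelDet (christoffel a (christoffel b m)) n := by
  -- Rows are taken in the basis `1, h - a, (h - a) h, …`, columns in `1, h - b, (h - b) h, …`.
  let F : ℕ → ℕ → R := fun i j => rebase a (fun i => rebase b (fun j => m (i + j)) j) i
  have hF : ∀ k, leadingMinor F k = hankelDet m k := fun k => by
    rw [leadingMinor_rebase_row (fun i j => rebase b (fun j => m (i + j)) j),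
      leadingMinor_rebase_col, hankelDet]
  have hF₁₁ : ∀ k, leadingMinor (fun i j => F (i + 1) (j + 1)) k =
      hankelDet (christoffel a (christoffel b m)) k := fun k => by
    unfold hankelDet
    congr 1
    funext i j
    simp only [F, rebase, christoffel]
    rw [show i + 1 + (j + 1) = i + j + 1 + 1 by ring, show i + 1 + j = i + j + 1 by ring,
      show i + (j + 1) = i + j + 1 by ring]
  have hF₁₀ : leadingMinor (fun i j => F (i + 1) j) (n + 1) =
      hankelDet (christoffel a m) (n + 1) := by
    rw [hankelDet, ← leadingMinor_rebase_col (fun i j => christoffel a m (i + j)) b]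
    congr 1
    funext i j
    rcases j with _ | j
    · rfl
    · simp only [F, rebase, christoffel]
      rw [show i + 1 + (j + 1) = i + j + 1 + 1 by ring, show i + 1 + j = i + j + 1 by ring,
        show i + (j + 1) = i + j + 1 by ring]
      ring
  have hF₀₁ : leadingMinor (fun i j => F i (j + 1)) (n + 1) =
      hankelDet (christoffel b m) (n + 1) := by
    rw [hankelDet, ← leadingMinor_rebase_row (fun i j => christoffel b m (i + j)) a]
    congr 1
  have h := leadingMinor_mul_interior F n
  rw [hF, hF, hF₁₁, hF₁₁, hF₁₀, hF₀₁] at h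
  linear_combination h

/-- The Christoffel–Darboux formula, written in Hankel determinants. -/
theorem hankelDet_christoffel_sub (m : ℕ → R) (a b : R) (n : ℕ) :
    hankelDet (christoffel a m) n * hankelDet (christoffel b m) (n + 1) -
        hankelDet (christoffel b m) n * hankelDet (christoffel a m) (n + 1) =
      (a - b) * hankelDet (christoffel a (christoffel b m)) n * hankelDet m (n + 1) := by
  -- The first row is the evaluation at `a`, the other ones are the moments.
  let G : ℕ → ℕ → R
    | 0, j => a ^ j
    | i + 1, j => m (i + j)
  let F : ℕ → ℕ → R := fun i => rebase b (G i)
  -- In the basis `1, h - a, (h - a) h, …` the evaluation at `a` is the first coordinate.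
  have hF : ∀ k, leadingMinor F (k + 1) = hankelDet (christoffel a m) k := fun k => by
    rw [leadingMinor_rebase_col G, ← leadingMinor_rebase_col G a, leadingMinor_succ_of_row_zero]
    · simp only [rebase, G, pow_zero, one_mul]
      rfl
    · intro j
      simp only [rebase, G]
      ring
  have hF₁₁ : ∀ k, leadingMinor (fun i j => F (i + 1) (j + 1)) k =
      hankelDet (christoffel b m) k := fun k => rfl
  have hF₁₀ : leadingMinor (fun i j => F (i + 1) j) (n + 1) = hankelDet m (n + 1) := by
    rw [hankelDet, ← leadingMinor_rebase_col (fun i j => m (i + j)) b]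
  have hF₀₁ : leadingMinor (fun i j => F i (j + 1)) (n + 1) =
      (a - b) * hankelDet (christoffel a (christoffel b m)) n := by
    rw [← leadingMinor_rebase_col (fun i j => F i (j + 1)) a, leadingMinor_succ_of_row_zero]
    · simp only [rebase, F, G, pow_zero, zero_add, pow_one, mul_one]
      rfl
    · intro j
      simp only [rebase, F, G]
      ring
  have h := leadingMinor_mul_interior F n
  rw [hF, hF, hF₁₁, hF₁₁, hF₁₀, hF₀₁] at h
  linear_combination -h

end Determinants

/-! ### The star of a node -/

section Star

/-- The squared norm `H_{k+1} / H_k` of the `k`-th monic orthogonal polynomial of the measure with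
moments `m`. -/
noncomputable def orthNorm {K : Type*} [Field K] (m : ℕ → K) (k : ℕ) : K :=
  hankelDet m (k + 1) / hankelDet m k

/-- The reciprocal `H_p / H_{p+1}` of the squared norm; unlike `orthNorm`, it is not a junk value as
soon as `H_{p+1}` is nonzero. -/
noncomputable def invOrthNorm {K : Type*} [Field K] (m : ℕ → K) (p : ℕ) : K :=
  hankelDet m p / hankelDet m (p + 1)

/-- The lattice potential KdV equation in its three-leg form: the long leg, joining the measures
`(h - b) dμ` and `(h - a) dμ`, equals the difference of the short legs `dμ` and
`(h - a) (h - b) dμ`. -/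
theorem sub_div_invOrthNorm_sub {K : Type*} [Field K] (m : ℕ → K) (a b : K) (p : ℕ)
    (ha : hankelDet (christoffel a m) (p + 1) ≠ 0) (hb : hankelDet (christoffel b m) (p + 1) ≠ 0)
    (hne : invOrthNorm (christoffel b m) p ≠ invOrthNorm (christoffel a m) p) :
    (a - b) / (invOrthNorm (christoffel b m) p - invOrthNorm (christoffel a m) p) =
      orthNorm m (p + 1) - orthNorm (christoffel a (christoffel b m)) p := by
  have hA := hankelDet_christoffel_sub m a b p
  have hB := hankelDet_christoffel_mul m a b p
  have hsub : invOrthNorm (christoffel b m) p - invOrthNorm (christoffel a m) p =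
      -((a - b) * hankelDet (christoffel a (christoffel b m)) p * hankelDet m (p + 1)) /
        (hankelDet (christoffel b m) (p + 1) * hankelDet (christoffel a m) (p + 1)) := by
    rw [← hA, invOrthNorm, invOrthNorm, div_sub_div _ _ hb ha]
    ring
  have h0 := sub_ne_zero.2 hne
  -- The nonvanishing of the difference provides that of all the factors of its numerator.
  rw [hsub] at h0 ⊢
  simp only [ne_eq, div_eq_zero_iff, neg_eq_zero, mul_eq_zero, not_or] at h0
  obtain ⟨⟨⟨h1, h2⟩, h3⟩, -⟩ := h0
  rw [orthNorm, orthNorm]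
  field_simp
  linear_combination -hB

/-- The moments `ℒ (r h^{j-p})`, `j = 0, 1, …`, of a functional `ℒ` with the weight `r`. -/
noncomputable def weightedMoments (ℒ : (ℂ → ℂ) →ₗ[ℂ] ℂ) (p : ℕ) (r : ℂ → ℂ) : ℕ → ℂ :=
  fun j => ℒ fun h => r h * h ^ ((j : ℤ) - p)

/-- The functional `ℒ` ignores the values of functions at `0` and at the points `α_i`. -/
def IgnoresPoles (α : Fin 3 → ℂ) (ℒ : (ℂ → ℂ) →ₗ[ℂ] ℂ) : Prop :=
  ∀ f g : ℂ → ℂ, (∀ h, h ≠ 0 → (∀ i, h ≠ α i) → f h = g h) → ℒ f = ℒ g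

variable {α : Fin 3 → ℂ} {ℒ : (ℂ → ℂ) →ₗ[ℂ] ℂ}

theorem christoffel_weightedMoments (hℒ : IgnoresPoles α ℒ) (p : ℕ) (a : ℂ) (r r' : ℂ → ℂ)
    (hr : ∀ h, (∀ i, h ≠ α i) → r' h = (h - a) * r h) :
    christoffel a (weightedMoments ℒ p r) = weightedMoments ℒ p r' := by
  funext j
  simp only [christoffel, weightedMoments]
  rw [← smul_eq_mul a, ← map_smul, ← map_sub]
  refine hℒ _ _ fun h h0 hα => ?_
  simp only [Pi.sub_apply, Pi.smul_apply, smul_eq_mul]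
  rw [hr h hα, show (((j + 1 : ℕ) : ℤ) - p) = (j : ℤ) - p + 1 by push_cast; ring, zpow_add_one₀ h0]
  ring

/-- The long leg from a node to a neighbour. The short legs are attached to the measures divided
by `h - α_k` and multiplied by `h - α_j`. -/
theorem sub_div_invOrthNorm_weightedMoments_sub (hℒ : IgnoresPoles α ℒ) (p : ℕ) (j k : Fin 3)
    (h₀ : hankelDet (weightedMoments ℒ p 1) (p + 1) ≠ 0)
    (h₁ : hankelDet (weightedMoments ℒ p fun h => (h - α j) / (h - α k)) (p + 1) ≠ 0)
    (hne : invOrthNorm (weightedMoments ℒ p 1) p ≠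
      invOrthNorm (weightedMoments ℒ p fun h => (h - α j) / (h - α k)) p) :
    (α j - α k) / (invOrthNorm (weightedMoments ℒ p 1) p -
        invOrthNorm (weightedMoments ℒ p fun h => (h - α j) / (h - α k)) p) =
      orthNorm (weightedMoments ℒ p fun h => 1 / (h - α k)) (p + 1) -
        orthNorm (weightedMoments ℒ p fun h => h - α j) p := by
  have hk : christoffel (α k) (weightedMoments ℒ p fun h => 1 / (h - α k)) =
      weightedMoments ℒ p 1 :=
    christoffel_weightedMoments hℒ p _ _ _ fun h hα => by
      have := sub_ne_zero.2 (hα k)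
      simp [this]
  have hj : christoffel (α j) (weightedMoments ℒ p fun h => 1 / (h - α k)) =
      weightedMoments ℒ p fun h => (h - α j) / (h - α k) :=
    christoffel_weightedMoments hℒ p _ _ _ fun h _ => by ring
  have hjk : christoffel (α j) (weightedMoments ℒ p 1) = weightedMoments ℒ p fun h => h - α j :=
    christoffel_weightedMoments hℒ p _ _ _ fun h _ => by simp
  have h := sub_div_invOrthNorm_sub (weightedMoments ℒ p fun h => 1 / (h - α k)) (α j) (α k) p
  rw [hk, hj, hjk] at h
  exact h h₁ h₀ hne

/-- In the sum of the long legs around a node every short leg occurs twice, with opposite signs. -/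
theorem sum_longLegs_eq_zero (hℒ : IgnoresPoles α ℒ) (p : ℕ) {Γ : Fin 3 → ℂ}
    (hΓ : ∀ i, Γ i = α (i + 1) - α (i - 1)) {c u : ℂ} {u₁ u₂ : Fin 3 → ℂ}
    (hu : u = c * invOrthNorm (weightedMoments ℒ p 1) p)
    (hu₁ : ∀ i, u₁ i =
      c * invOrthNorm (weightedMoments ℒ p fun h => (h - α (i + 1)) / (h - α (i - 1))) p)
    (hu₂ : ∀ i, u₂ i =
      c * invOrthNorm (weightedMoments ℒ p fun h => (h - α (i - 1)) / (h - α (i + 1))) p)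
    (h₀ : hankelDet (weightedMoments ℒ p 1) (p + 1) ≠ 0)
    (h₁ : ∀ i, hankelDet (weightedMoments ℒ p fun h => (h - α (i + 1)) / (h - α (i - 1)))
      (p + 1) ≠ 0)
    (h₂ : ∀ i, hankelDet (weightedMoments ℒ p fun h => (h - α (i - 1)) / (h - α (i + 1)))
      (p + 1) ≠ 0)
    (hne₁ : ∀ i, u ≠ u₁ i) (hne₂ : ∀ i, u ≠ u₂ i) :
    ∑ i, Γ i * (1 / (u - u₁ i) + 1 / (u - u₂ i)) = 0 := by
  let v₁ : Fin 3 → ℂ := fun j => orthNorm (weightedMoments ℒ p fun h => h - α j) p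
  let v₂ : Fin 3 → ℂ := fun j => orthNorm (weightedMoments ℒ p fun h => 1 / (h - α j)) (p + 1)
  have key : ∀ i, Γ i * (1 / (u - u₁ i) + 1 / (u - u₂ i)) =
      c⁻¹ * ((v₂ (i - 1) - v₁ (i + 1)) - (v₂ (i + 1) - v₁ (i - 1))) := by
    intro i
    have e₁ := sub_div_invOrthNorm_weightedMoments_sub hℒ p (i + 1) (i - 1) h₀ (h₁ i)
      fun h => hne₁ i (by rw [hu, hu₁, h])
    have e₂ := sub_div_invOrthNorm_weightedMoments_sub hℒ p (i - 1) (i + 1) h₀ (h₂ i)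
      fun h => hne₂ i (by rw [hu, hu₂, h])
    rw [hΓ, hu, hu₁, hu₂, ← e₁, ← e₂, ← mul_sub, ← mul_sub, one_div, one_div, mul_inv, mul_inv]
    ring
  rw [Finset.sum_congr rfl fun i _ => key i, Fin.sum_univ_three]
  have a1 : (0 : Fin 3) - 1 = 2 := rfl
  have a2 : (1 : Fin 3) - 1 = 0 := rfl
  have a3 : (2 : Fin 3) - 1 = 1 := rfl
  have a4 : (0 : Fin 3) + 1 = 1 := rfl
  have a5 : (1 : Fin 3) + 1 = 2 := rfl
  have a6 : (2 : Fin 3) + 1 = 0 := rfl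
  rw [a1, a2, a3, a4, a5, a6]
  ring

end Star

/-! ### Geometry of the lattice -/

section Lattice

variable {e : Fin 3 → Plane} {s : ℝ}

theorem add_edgeVec_mem_triLattice {n : Plane} (hn : n ∈ triLattice e) (i : Fin 3) :
    n + edgeVec e i ∈ triLattice e := by
  obtain ⟨c, rfl⟩ := hn
  refine ⟨c + Pi.single i 1, ?_⟩
  simp [add_smul, Finset.sum_add_distrib, Pi.single_apply, ite_smul]

theorem sub_edgeVec_mem_triLattice {n : Plane} (hn : n ∈ triLattice e) (i : Fin 3) :
    n - edgeVec e i ∈ triLattice e := by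
  obtain ⟨c, rfl⟩ := hn
  refine ⟨c - Pi.single i 1, ?_⟩
  simp [sub_smul, Finset.sum_sub_distrib, Pi.single_apply, ite_smul]

theorem IsEquilateralFrame.inner_self (he : IsEquilateralFrame e s) (i : Fin 3) :
    inner ℝ (e i) (e i) = s ^ 2 := by
  rw [real_inner_self_eq_norm_sq, he.2.1]

theorem IsEquilateralFrame.inner_succ (he : IsEquilateralFrame e s) (i : Fin 3) :
    inner ℝ (e i) (e (i + 1)) = -s ^ 2 / 2 := by
  have hcos : Real.cos (2 * Real.pi / 3) = -(1 / 2) := by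
    rw [show 2 * Real.pi / 3 = Real.pi - Real.pi / 3 by ring, Real.cos_pi_sub, Real.cos_pi_div_three]
  rw [← InnerProductGeometry.cos_angle_mul_norm_mul_norm, he.2.2, he.2.1, he.2.1, hcos]
  ring

theorem scalarProd_phi (α : Fin 3 → ℂ) (h : ℂ) (n : Plane) :
    scalarProd (phi e s α h) n =
      2 / (3 * (s : ℂ) ^ 2) * ∑ i, ((inner ℝ (e i) n : ℝ) : ℂ) * Complex.log (h - α i) := by
  simp only [scalarProd, phi, PiLp.inner_apply, Fin.sum_univ_two, Fin.sum_univ_three,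
    RCLike.inner_apply, conj_trivial, Complex.ofReal_add, Complex.ofReal_mul]
  ring

theorem scalarProd_phi_add_edgeVec (he : IsEquilateralFrame e s) (α : Fin 3 → ℂ) (h : ℂ)
    (n : Plane) (i : Fin 3) :
    scalarProd (phi e s α h) (n + edgeVec e i) = scalarProd (phi e s α h) n +
      (Complex.log (h - α (i + 1)) - Complex.log (h - α (i - 1))) := by
  have hs : (s : ℂ) ≠ 0 := Complex.ofReal_ne_zero.2 he.1.ne'
  have hself := he.inner_self
  have h01 : inner ℝ (e 0) (e 1) = -s ^ 2 / 2 := he.inner_succ 0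
  have h12 : inner ℝ (e 1) (e 2) = -s ^ 2 / 2 := he.inner_succ 1
  have h20 : inner ℝ (e 2) (e 0) = -s ^ 2 / 2 := he.inner_succ 2
  have h10 := real_inner_comm (e 0) (e 1) ▸ h01
  have h21 := real_inner_comm (e 1) (e 2) ▸ h12
  have h02 := real_inner_comm (e 2) (e 0) ▸ h20
  rw [scalarProd_phi, scalarProd_phi]
  simp only [edgeVec, Fin.sum_univ_three, inner_add_right, inner_sub_right]
  have a1 : (0 : Fin 3) - 1 = 2 := rfl
  have a2 : (1 : Fin 3) - 1 = 0 := rfl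
  have a3 : (2 : Fin 3) - 1 = 1 := rfl
  have a4 : (0 : Fin 3) + 1 = 1 := rfl
  have a5 : (1 : Fin 3) + 1 = 2 := rfl
  have a6 : (2 : Fin 3) + 1 = 0 := rfl
  fin_cases i <;>
    simp only [Fin.zero_eta, Fin.mk_one, Fin.reduceFinMk, a1, a2, a3, a4, a5, a6, hself, h01, h12,
      h20, h10, h21, h02] <;> push_cast <;> field_simp <;> ring

/-- A step along `g_i` multiplies the exponential by `(h - α_{i+1}) / (h - α_{i-1})`. -/
theorem exp_scalarProd_phi_add_edgeVec (he : IsEquilateralFrame e s) (α : Fin 3 → ℂ) {h : ℂ}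
    (hα : ∀ i, h ≠ α i) (n : Plane) (i : Fin 3) :
    Complex.exp (scalarProd (phi e s α h) (n + edgeVec e i)) =
      (h - α (i + 1)) / (h - α (i - 1)) * Complex.exp (scalarProd (phi e s α h) n) := by
  rw [scalarProd_phi_add_edgeVec he, Complex.exp_add, Complex.exp_sub,
    Complex.exp_log (sub_ne_zero.2 (hα _)), Complex.exp_log (sub_ne_zero.2 (hα _)), mul_comm]

theorem exp_scalarProd_phi_sub_edgeVec (he : IsEquilateralFrame e s) (α : Fin 3 → ℂ) {h : ℂ}
    (hα : ∀ i, h ≠ α i) (n : Plane) (i : Fin 3) :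
    Complex.exp (scalarProd (phi e s α h) (n - edgeVec e i)) =
      (h - α (i - 1)) / (h - α (i + 1)) * Complex.exp (scalarProd (phi e s α h) n) := by
  have h1 := exp_scalarProd_phi_add_edgeVec he α hα (n - edgeVec e i) i
  rw [sub_add_cancel] at h1
  have := sub_ne_zero.2 (hα (i + 1))
  have := sub_ne_zero.2 (hα (i - 1))
  rw [h1]
  field_simp

end Lattice

/-! ### The moments as values of a linear functional -/

section Moments

open MeasureTheory

/-- A curve passes through a given point with nonzero velocity at most countably many times. -/
theorem countable_setOf_eq_and_deriv_ne_zero (f : ℝ → ℂ) (c : ℂ) :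
    {t | f t = c ∧ deriv f t ≠ 0}.Countable := by
  have hd : DiscreteTopology {t | f t = c ∧ deriv f t ≠ 0} := by
    rw [discreteTopology_subtype_iff]
    rintro t ⟨-, ht⟩
    have hne := (differentiableAt_of_deriv_ne_zero ht).hasDerivAt.eventually_ne (c := c) ht
    rw [← disjoint_iff, Filter.disjoint_principal_right]
    filter_upwards [hne] with z hz hz'
    exact hz hz'.1
  exact Set.countable_coe_iff.1 (TopologicalSpace.separableSpace_iff_countable.1 inferInstance)

/-- The integral over the integrable functions extends to a linear functional on all functions. -/
theorem exists_linearMap_eq_integral {X : Type*} [MeasurableSpace X] (μ : Measure X) :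
    ∃ L : (X → ℂ) →ₗ[ℂ] ℂ, ∀ f, Integrable f μ → L f = ∫ x, f x ∂μ := by
  let V : Submodule ℂ (X → ℂ) :=
    { carrier := {f | Integrable f μ}
      add_mem' := fun hf hg => hf.add hg
      zero_mem' := integrable_zero _ _ _
      smul_mem' := fun c _ hf => hf.smul c }
  let I : V →ₗ[ℂ] ℂ :=
    { toFun := fun f => ∫ x, (f : X → ℂ) x ∂μ
      map_add' := fun f g => integral_add f.2 g.2
      map_smul' := fun c f => integral_smul c _ }
  obtain ⟨L, hL⟩ := I.exists_extend
  exact ⟨L, fun f hf => LinearMap.congr_fun hL ⟨f, hf⟩⟩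

variable (e : Fin 3 → Plane) (s : ℝ) (α : Fin 3 → ℂ) (γ : Contour) (ωhat : ℂ → ℂ)

/-- For every node `n` there is a linear functional on all functions that represents every
absolutely convergent moment at every node `n'` whose exponential differs from the one at `n` by a
rational factor. The values taken off the integrable functions are arbitrary: the identities in
which they occur hold for every functional. -/
theorem exists_functional_eq_moment (n : Plane) :
    ∃ ℒ : (ℂ → ℂ) →ₗ[ℂ] ℂ, IgnoresPoles α ℒ ∧
      ∀ (n' : Plane) (m : ℤ) (r : ℂ → ℂ), γ.Integrable (momentIntegrand e s α ωhat m n') →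
        (∀ h, (∀ i, h ≠ α i) → Complex.exp (scalarProd (phi e s α h) n') =
          r h * Complex.exp (scalarProd (phi e s α h) n)) →
        moment e s α γ ωhat m n' = ℒ fun h => r h * h ^ m := by
  classical
  obtain ⟨L, hL⟩ := exists_linearMap_eq_integral (volume.restrict γ.dom)
  let good : ℂ → Prop := fun h => h ≠ 0 ∧ ∀ i, h ≠ α i
  let w : ℝ → ℂ := fun t => ωhat (γ.param t) *
    Complex.exp (scalarProd (phi e s α (γ.param t)) n) * deriv γ.param t
  let T : (ℂ → ℂ) →ₗ[ℂ] (ℝ → ℂ) :=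
    { toFun := fun f t => if good (γ.param t) then f (γ.param t) * w t else 0
      map_add' := fun f g => by
        funext t
        by_cases ht : good (γ.param t) <;> simp [ht, add_mul]
      map_smul' := fun c f => by
        funext t
        by_cases ht : good (γ.param t) <;> simp [ht, mul_assoc] }
  refine ⟨L ∘ₗ T, fun f g hfg => ?_, fun n' m r hint hr => ?_⟩
  · have : T f = T g := by
      funext t
      by_cases ht : good (γ.param t)
      · simp [T, ht, hfg _ ht.1 ht.2]
      · simp [T, ht]
    simp [this]
  · -- Parameters of zero velocity contribute nothing, and the other parameters at which the curve
    -- meets an exceptional point form a countable set.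
    have hnull : ∀ c, ∀ᵐ t ∂volume.restrict γ.dom, ¬ (γ.param t = c ∧ deriv γ.param t ≠ 0) :=
      fun c => ae_restrict_of_ae
        (measure_eq_zero_iff_ae_notMem.1
          ((countable_setOf_eq_and_deriv_ne_zero γ.param c).measure_zero volume))
    have hae : (fun t => momentIntegrand e s α ωhat m n' (γ.param t) * deriv γ.param t)
        =ᵐ[volume.restrict γ.dom] T fun h => r h * h ^ m := by
      filter_upwards [hnull 0, ae_all_iff.2 fun i => hnull (α i)] with t h0 hα
      by_cases hd : deriv γ.param t = 0
      · simp [T, w, hd]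
      · have ht : good (γ.param t) := ⟨fun h => h0 ⟨h, hd⟩, fun i h => hα i ⟨h, hd⟩⟩
        simp only [T, w, momentIntegrand, LinearMap.coe_mk, AddHom.coe_mk, if_pos ht]
        rw [hr _ ht.2]
        ring
    rw [LinearMap.comp_apply, hL _ (Integrable.congr hint hae)]
    exact integral_congr_ae hae

end Moments

/-! ### Toeplitz determinants as Hankel determinants -/

section Toeplitz

/-- Reversing the order of the rows turns a Toeplitz determinant into a Hankel determinant. -/
theorem det_toeplitz_eq_sign_mul_hankelDet (ω : ℤ → ℂ) (k : ℤ) (N : ℕ) :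
    Matrix.det (Matrix.of fun a b : Fin N => ω (k - ((a : ℕ) : ℤ) + ((b : ℕ) : ℤ))) =
      ((Equiv.Perm.sign (Fin.revPerm : Equiv.Perm (Fin N)) : ℤ) : ℂ) *
        hankelDet (fun j => ω (k + 1 - N + j)) N := by
  rw [hankelDet, leadingMinor, ← Matrix.det_permute]
  congr 1
  ext a b
  simp only [Matrix.of_apply, Matrix.submatrix_apply, Fin.revPerm_apply, Fin.val_rev, id]
  congr 1
  have := a.2
  push_cast [Nat.cast_sub (show (a : ℕ) + 1 ≤ N by omega)]
  ring

theorem hankelDet_congr {m m' : ℕ → ℂ} {N : ℕ} (h : ∀ j, j + 1 < 2 * N → m j = m' j) :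
    hankelDet m N = hankelDet m' N := by
  unfold hankelDet leadingMinor
  congr 1
  ext i j
  exact h _ (by omega)

theorem toeplitzD_zero (ω : ℤ → ℂ) (p : ℕ) :
    toeplitzD ω (p + 1) 0 =
      ((Equiv.Perm.sign (Fin.revPerm : Equiv.Perm (Fin (p + 1))) : ℤ) : ℂ) *
        hankelDet (fun j => ω (j - p)) (p + 1) := by
  have hN : (((p + 1 : ℕ) : ℤ) + 0).toNat = p + 1 := by omega
  rw [toeplitzD, hN, det_toeplitz_eq_sign_mul_hankelDet]
  congr 2
  funext j
  congr 1
  push_cast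
  ring

theorem toeplitzD_neg_one (ω : ℤ → ℂ) (p : ℕ) :
    toeplitzD ω (p + 1) (-1) =
      ((Equiv.Perm.sign (Fin.revPerm : Equiv.Perm (Fin p)) : ℤ) : ℂ) *
        hankelDet (fun j => ω (j - p)) p := by
  have hN : (((p + 1 : ℕ) : ℤ) + -1).toNat = p := by omega
  rw [toeplitzD, hN, det_toeplitz_eq_sign_mul_hankelDet]
  congr 2
  funext j
  congr 1
  ring

end Toeplitz

/-! ### The field equation -/

theorem mainTheorem5
    (e : Fin 3 → Plane) (s : ℝ) (he : IsEquilateralFrame e s)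
    (α Γ : Fin 3 → ℂ) (hΓ : ∀ i, Γ i = α (i + 1) - α (i - 1))
    (ℓ : ℕ) (hℓ : 0 < ℓ) (γ : Contour) (ωhat : ℂ → ℂ)
    (hint : ∀ n ∈ triLattice e, ∀ m : ℤ, |m| < (ℓ : ℤ) →
      γ.Integrable (momentIntegrand e s α ωhat m n))
    (n : Plane) (hn : n ∈ triLattice e)
    (hD : latticeD e s α γ ωhat ℓ 0 n ≠ 0)
    (hDg : ∀ i, latticeD e s α γ ωhat ℓ 0 (n + edgeVec e i) ≠ 0 ∧
      latticeD e s α γ ωhat ℓ 0 (n - edgeVec e i) ≠ 0)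
    (hu : ∀ i,
      toeplitzU e s α γ ωhat ℓ n ≠ toeplitzU e s α γ ωhat ℓ (n + edgeVec e i) ∧
      toeplitzU e s α γ ωhat ℓ n ≠ toeplitzU e s α γ ωhat ℓ (n - edgeVec e i)) :
    TLEquationAt e Γ (toeplitzU e s α γ ωhat ℓ) n := by
  obtain ⟨p, rfl⟩ : ∃ p, ℓ = p + 1 := ⟨ℓ - 1, by omega⟩
  obtain ⟨ℒ, hℒ, hmom⟩ := exists_functional_eq_moment e s α γ ωhat n
  let ε : ℕ → ℂ := fun N => ((Equiv.Perm.sign (Fin.revPerm : Equiv.Perm (Fin N)) : ℤ) : ℂ)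
  -- The moments occurring in the determinants are those with `|m| ≤ p`.
  have hmoments : ∀ n' ∈ triLattice e, ∀ r : ℂ → ℂ,
      (∀ h, (∀ i, h ≠ α i) → Complex.exp (scalarProd (phi e s α h) n') =
        r h * Complex.exp (scalarProd (phi e s α h) n)) →
      ∀ j : ℕ, j < 2 * p + 1 →
        moment e s α γ ωhat ((j : ℤ) - p) n' = weightedMoments ℒ p r j :=
    fun n' hn' r hr j hj => hmom n' _ r
      (hint n' hn' _ (by rw [abs_lt]; push_cast; constructor <;> omega)) hr
  have hD0 : ∀ n' ∈ triLattice e, ∀ r : ℂ → ℂ,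
      (∀ h, (∀ i, h ≠ α i) → Complex.exp (scalarProd (phi e s α h) n') =
        r h * Complex.exp (scalarProd (phi e s α h) n)) →
      latticeD e s α γ ωhat (p + 1) 0 n' =
        ε (p + 1) * hankelDet (weightedMoments ℒ p r) (p + 1) := fun n' hn' r hr => by
    rw [latticeD, toeplitzD_zero]
    congr 1
    exact hankelDet_congr fun j hj => hmoments n' hn' r hr j (by omega)
  have hU : ∀ n' ∈ triLattice e, ∀ r : ℂ → ℂ,
      (∀ h, (∀ i, h ≠ α i) → Complex.exp (scalarProd (phi e s α h) n') =
        r h * Complex.exp (scalarProd (phi e s α h) n)) →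
      toeplitzU e s α γ ωhat (p + 1) n' =
        ε p / ε (p + 1) * invOrthNorm (weightedMoments ℒ p r) p := fun n' hn' r hr => by
    rw [toeplitzU, hD0 n' hn' r hr, latticeD, toeplitzD_neg_one, invOrthNorm, div_mul_div_comm]
    congr 2
    exact hankelDet_congr fun j hj => hmoments n' hn' r hr j (by omega)
  have r₀ : ∀ h, (∀ i, h ≠ α i) → Complex.exp (scalarProd (phi e s α h) n) =
      (1 : ℂ → ℂ) h * Complex.exp (scalarProd (phi e s α h) n) := fun h _ => by simp
  have r₁ := fun i h hα => exp_scalarProd_phi_add_edgeVec (h := h) he α hα n i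
  have r₂ := fun i h hα => exp_scalarProd_phi_sub_edgeVec (h := h) he α hα n i
  have m₁ := add_edgeVec_mem_triLattice hn
  have m₂ := sub_edgeVec_mem_triLattice hn
  have hne : ∀ {H : ℂ}, ε (p + 1) * H ≠ 0 → H ≠ 0 := right_ne_zero_of_mul
  exact sum_longLegs_eq_zero hℒ p hΓ (hU n hn _ r₀) (fun i => hU _ (m₁ i) _ (r₁ i))
    (fun i => hU _ (m₂ i) _ (r₂ i)) (hne (hD0 n hn _ r₀ ▸ hD))
    (fun i => hne (hD0 _ (m₁ i) _ (r₁ i) ▸ (hDg i).1))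
    (fun i => hne (hD0 _ (m₂ i) _ (r₂ i) ▸ (hDg i).2)) (fun i => (hu i).1) fun i => (hu i).2
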